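/- Equip $\mathbb{Z}^2$ with the Euclidean distance $d_2$, write $B(x,s)=\{z\in\mathbb{Z}^2 : d_2(x,z)\le s\}$, and let $\mathcal{D}=\{d_2(x,y) : x,y\in\mathbb{Z}^2\}$ be the set of achievable distances. A set $C\subseteq\mathbb{Z}^2$ is a perfect code if for some real $s>0$ every $z\in\mathbb{Z}^2$ lies in $B(x,s)$ for exactly one $x\in C$. The packing radius of $C$ is the largest $r\in\mathcal{D}$ such that the balls $B(x,r)$, $x\in C$, are pairwise disjoint. A linear $r$-perfect code is an additive subgroup $\Lambda\subseteq\mathbb{Z}^2$ that is a perfect code with packing radius $r$; equivalently, $r \in \mathcal{D}$ and the balls $B(x,r)$, $x\in\Lambda$, tile $\mathbb{Z}^2$. **Theorem.** If $r>0$ and there is a linear $r$-perfect code in $\mathbb{Z}^2$ in the $\ell_2$ metric, then $r\in\{1,\sqrt2,2,2\sqrt2\}$. Conversely, each of these radii occurs: the subgroups of $\mathbb{Z}^2$ generated by $\{(1,2),(0,5)\}$, $\{(3,2),(0,3)\}$, $\{(1,5),(3,2)\}$ and $\{(5,4),(0,5)\}$ are linear $r$-perfect codes for $r=1$, $\sqrt2$,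 $2$ and $2\sqrt2$, respectively. -/

import Mathlib

/-- The `ℓ₂` distance between two points of `ℤⁿ`. -/
noncomputable def l2Dist {n : ℕ} (x y : Fin n → ℤ) : ℝ :=
  Real.sqrt (∑ i, ((x i : ℝ) - (y i : ℝ)) ^ 2)

/-- The closed `ℓ₂` ball in `ℤⁿ` with centre `x` and radius `r`. -/
def l2Ball {n : ℕ} (x : Fin n → ℤ) (r : ℝ) : Set (Fin n → ℤ) :=
  {z | l2Dist x z ≤ r}

/-- The set of all `ℓ₂` distances achieved between points of `ℤⁿ`. -/
def l2DistanceSet (n : ℕ) : Set ℝ :=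
  {d | ∃ x y : Fin n → ℤ, l2Dist x y = d}

/-- `C ⊆ ℤⁿ` is a perfect code in the `ℓ₂` metric: for some radius `s > 0`, every point of `ℤⁿ`
lies in the ball of radius `s` around exactly one codeword. -/
def IsPerfectCode {n : ℕ} (C : Set (Fin n → ℤ)) : Prop :=
  ∃ s : ℝ, 0 < s ∧ ∀ z : Fin n → ℤ, ∃! x, x ∈ C ∧ l2Dist x z ≤ s

/-- `r` is the packing radius of `C ⊆ ℤⁿ`: the largest achievable distance for which the balls of
that radius around distinct codewords are disjoint. -/
def IsPackingRadius {n : ℕ} (C : Set (Fin n → ℤ)) (r : ℝ) : Prop :=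
  IsGreatest {s | s ∈ l2DistanceSet n ∧ C.PairwiseDisjoint (fun x => l2Ball x s)} r

/-- An `r`-perfect code: a perfect code whose packing radius is `r`. -/
def IsRPerfectCode {n : ℕ} (C : Set (Fin n → ℤ)) (r : ℝ) : Prop :=
  IsPerfectCode C ∧ IsPackingRadius C r

/-! With `R = r ^ 2`, a linear `r`-perfect code is a subgroup `G` whose translates of the ball of
squared radius `R` tile the plane (`IsRPerfectCode.isBallTiling`). Disjointness makes the shortest
nonzero `v ∈ G` almost as long as `2√R` (`IsBallTiling.four_mul_lt`). Covering bounds it above: the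
circumcentre of a reduced triangle is at least `|v| / √3` from every point of `G`, while a nearby
integer point is within `√R` of one (`exists_far_point`). As `2 > √3`, `R` is bounded:
`IsBallTiling.lt` gives `R < 72`.

The remaining sums of two squares, except 1, 2, 4 and 8, fall to a finite search: points just
outside the ball must be covered by centres in `G`, and no choice of centres has all pairwise sums
and differences compatible with disjointness. For the four examples the ball is a complete residue
system for the subgroup. -/

/-- The squared Euclidean norm on `ℤ × ℤ`. -/
def normSqPair (v : ℤ × ℤ) : ℤ := v.1 * v.1 + v.2 * v.2

/-- The translates by `G` of the ball `{b | normSqPair b ≤ R}` tile `ℤ × ℤ`. -/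
structure IsBallTiling (G : AddSubgroup (ℤ × ℤ)) (R : ℤ) : Prop where
  covers : ∀ p, ∃ v ∈ G, normSqPair (p - v) ≤ R
  disjoint : ∀ v ∈ G, v ≠ 0 → ∀ b, normSqPair b ≤ R → R < normSqPair (v - b)

/-! ### The search that excludes individual radii. -/

/-- The value `f n`, arranged so that kernel reduction evaluates `n` before applying `f`. -/
def forceNat (n : ℕ) (f : ℕ → Bool) : Bool :=
  match n with
  | 0 => f 0
  | k + 1 => f (k + 1)

theorem forceNat_eq (n : ℕ) (f : ℕ → Bool) : forceNat n f = f n := by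
  cases n <;> rfl

/-- The value `f z`, arranged so that kernel reduction evaluates `z` before applying `f`. -/
def forceInt (z : ℤ) (f : ℤ → Bool) : Bool :=
  match z with
  | Int.ofNat n => forceNat n fun n => f (Int.ofNat n)
  | Int.negSucc n => forceNat n fun n => f (Int.negSucc n)

theorem forceInt_eq (z : ℤ) (f : ℤ → Bool) : forceInt z f = f z := by
  cases z <;> simp [forceInt, forceNat_eq]

/-- The value `f l`, arranged so that kernel reduction evaluates `l` before applying `f`. -/
def forceList : List (ℤ × ℤ) → (List (ℤ × ℤ) → Bool) → Bool
  | [], f => f []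
  | v :: l, f => forceInt v.1 fun x => forceInt v.2 fun y => forceList l fun l' => f ((x, y) :: l')

theorem forceList_eq (l : List (ℤ × ℤ)) (f : List (ℤ × ℤ) → Bool) : forceList l f = f l := by
  induction l generalizing f with
  | nil => rfl
  | cons v l ih => simp [forceList, forceInt_eq, ih]

/-- A sufficient test for `(x, y)` to be nonzero and a sum of two points of the ball: it is split
into two nearly equal halves. -/
def splitsInBall (R : ℤ) (x y : ℤ) : Bool :=
  forceInt x fun x => forceInt y fun y =>
  forceInt (x / 2) fun x' => forceInt (y / 2) fun y' =>
  forceInt (x - x') fun x'' => forceInt (y - y') fun y'' =>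
  !(decide (x = 0) && decide (y = 0)) &&
    ((decide (normSqPair (x', y') ≤ R) && decide (normSqPair (x'', y'') ≤ R)) ||
      (decide (normSqPair (x', y'') ≤ R) && decide (normSqPair (x'', y') ≤ R)))

/-- The integers of absolute value at most `n`. -/
def symmRange (n : ℕ) : List ℤ :=
  (List.range (2 * n + 1)).map fun k : ℕ => (k : ℤ) - n

/-- Vectors `v` such that the ball centred at `v` contains `p`, excluding those that
`splitsInBall` detects to be sums of two points of the ball. -/
def coverCandidates (R : ℤ) (n : ℕ) (p : ℤ × ℤ) : List (ℤ × ℤ) :=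
  (symmRange n).flatMap fun i => ((symmRange n).filter fun j =>
    decide (normSqPair (i, j) ≤ R) && !splitsInBall R (p.1 + i) (p.2 + j)).map
      fun j => (p.1 + i, p.2 + j)

/-- Backtracking search showing that one cannot choose a vector from each of the given lists so
that these vectors and those of `V` lie in a common subgroup with disjoint balls. -/
def refutesChoice (R : ℤ) : List (List (ℤ × ℤ)) → List (ℤ × ℤ) → Bool
  | [], _ => false
  | L :: Ls, V => L.all fun v =>
      V.any (fun w => splitsInBall R (v.1 - w.1) (v.2 - w.2) ||
        splitsInBall R (v.1 + w.1) (v.2 + w.2)) || refutesChoice R Ls (v :: V)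

/-- Backtracking search showing that the points of `ps` cannot all be covered. -/
def refutesCover (R : ℤ) (n : ℕ) : List (ℤ × ℤ) → List (List (ℤ × ℤ)) → Bool
  | [], Ls => refutesChoice R Ls []
  | p :: ps, Ls => forceList (coverCandidates R n p) fun L => refutesCover R n ps (L :: Ls)

/-- The least `y < 20` with `R < g y`. -/
def firstOutside (R : ℕ) (g : ℕ → ℕ) : ℕ :=
  ((List.range 20).find? fun y => decide (R < g y)).getD 0

/-- Points just outside the ball, used as targets for the search. -/
def outerPoints (R : ℕ) : List (ℤ × ℤ) :=
  let m : ℕ := firstOutside R fun y => y * y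
  let d : ℕ := firstOutside R fun y => 2 * (y * y)
  let e : ℕ := firstOutside R fun y => (m - 1) * (m - 1) + y * y
  -- First points outside on the axes, on the diagonals and in the column `x = m - 1`.
  -- `refutesCover` reverses the order, so the axis points are branched on first. Soundness does not
  -- depend on this choice.
  [((m - 1 : ℕ), -(e : ℤ)), ((m - 1 : ℕ), (e : ℤ)), ((d : ℤ), -(d : ℤ)), ((d : ℤ), (d : ℤ)),
    ((m : ℤ), 0), (0, (m : ℤ))]

/-! ### Soundness of the search. -/

/-- If `v = b + b'` with both summands in the ball, then `b` lies in the balls around `0` and `v`.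
-/
theorem IsBallTiling.not_splitsInBall {G : AddSubgroup (ℤ × ℤ)} {R : ℤ} (h : IsBallTiling G R)
    {v : ℤ × ℤ} (hv : v ∈ G) : splitsInBall R v.1 v.2 = false := by
  rw [← Bool.not_eq_true]
  intro hs
  simp only [splitsInBall, forceInt_eq, Bool.and_eq_true, Bool.or_eq_true,
    Bool.not_eq_true', decide_eq_true_eq] at hs
  obtain ⟨h0, h12⟩ := hs
  have h0 : v ≠ 0 := by rintro rfl; simp at h0
  obtain ⟨h1, h2⟩ | ⟨h1, h2⟩ := h12
  · exact absurd (h.disjoint v hv h0 _ h1) (not_lt.2 h2)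
  · refine absurd (h.disjoint v hv h0 _ h1) (not_lt.2 ?_)
    simpa [normSqPair] using h2

theorem mem_symmRange {n : ℕ} {i : ℤ} (h : i * i < (n + 1) * (n + 1)) : i ∈ symmRange n := by
  have h1 : -(n + 1 : ℤ) < i := by nlinarith
  have h2 : i < (n + 1 : ℤ) := by nlinarith
  simp only [symmRange, List.mem_map, List.mem_range]
  exact ⟨(i + n).toNat, by omega, by omega⟩

theorem IsBallTiling.exists_mem_coverCandidates {G : AddSubgroup (ℤ × ℤ)} {R : ℤ} {n : ℕ}
    (h : IsBallTiling G R) (hn : R < (n + 1) * (n + 1)) (p : ℤ × ℤ) :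
    ∃ v ∈ coverCandidates R n p, v ∈ G := by
  obtain ⟨v, hv, hpv⟩ := h.covers p
  have hb : normSqPair (v.1 - p.1, v.2 - p.2) ≤ R := by
    refine le_trans (le_of_eq ?_) hpv
    simp only [normSqPair, Prod.fst_sub, Prod.snd_sub]; ring
  have hb' := hb
  simp only [normSqPair] at hb'
  refine ⟨v, ?_, hv⟩
  simp only [coverCandidates, List.mem_flatMap, List.mem_map, List.mem_filter]
  refine ⟨v.1 - p.1, mem_symmRange (by nlinarith [mul_self_nonneg (v.2 - p.2)]), v.2 - p.2,
    ⟨mem_symmRange (by nlinarith [mul_self_nonneg (v.1 - p.1)]), ?_⟩, ?_⟩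
  · rw [add_sub_cancel, add_sub_cancel, h.not_splitsInBall hv]
    simpa using hb
  · rw [add_sub_cancel, add_sub_cancel]

/-- The branch that always picks a member of `G` survives, since sums and differences stay in `G`.
-/
theorem IsBallTiling.refutesChoice_eq_false {G : AddSubgroup (ℤ × ℤ)} {R : ℤ}
    (h : IsBallTiling G R) (Ls : List (List (ℤ × ℤ))) (hLs : ∀ L ∈ Ls, ∃ v ∈ L, v ∈ G)
    (V : List (ℤ × ℤ)) (hV : ∀ w ∈ V, w ∈ G) : refutesChoice R Ls V = false := by
  induction Ls generalizing V with
  | nil => rfl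
  | cons L Ls ih =>
    obtain ⟨v, hvL, hv⟩ := hLs L (by simp)
    rw [← Bool.not_eq_true, refutesChoice, List.all_eq_true]
    intro hs
    have hs := hs v hvL
    rw [ih (fun L' hL' => hLs L' (by simp [hL'])) (v :: V) (by simpa [hv] using hV)] at hs
    simp only [Bool.or_false, List.any_eq_true, Bool.or_eq_true] at hs
    obtain ⟨w, hw, hs | hs⟩ := hs
    · exact Bool.false_ne_true ((h.not_splitsInBall (G.sub_mem hv (hV w hw))).symm.trans hs)
    · exact Bool.false_ne_true ((h.not_splitsInBall (G.add_mem hv (hV w hw))).symm.trans hs)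

theorem IsBallTiling.refutesCover_eq_false {G : AddSubgroup (ℤ × ℤ)} {R : ℤ} {n : ℕ}
    (h : IsBallTiling G R) (hn : R < (n + 1) * (n + 1)) (ps : List (ℤ × ℤ))
    (Ls : List (List (ℤ × ℤ))) (hLs : ∀ L ∈ Ls, ∃ v ∈ L, v ∈ G) :
    refutesCover R n ps Ls = false := by
  induction ps generalizing Ls with
  | nil => exact h.refutesChoice_eq_false Ls hLs [] (by simp)
  | cons p ps ih =>
    rw [refutesCover, forceList_eq]
    exact ih _ (List.forall_mem_cons.2 ⟨h.exists_mem_coverCandidates hn p, hLs⟩)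

/-- The test that no subgroup tiles with balls of squared radius `R`. -/
def refutesTiling (R : ℕ) : Bool :=
  let n := firstOutside R (fun y => y * y) - 1
  decide ((R : ℤ) < (n + 1) * (n + 1)) && refutesCover R n (outerPoints R) []

theorem not_isBallTiling_of_refutesTiling {G : AddSubgroup (ℤ × ℤ)} {R : ℕ}
    (hR : refutesTiling R = true) : ¬ IsBallTiling G R := by
  intro h
  simp only [refutesTiling, Bool.and_eq_true, decide_eq_true_eq] at hR
  rw [h.refutesCover_eq_false hR.1 _ _ (by simp)] at hR
  simp at hR

theorem refutesTiling_of_lt (R : ℕ) (h5 : 5 ≤ R) (h8 : R ≠ 8) (hR : R < 72)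
    (hsq : ∃ i < 9, ∃ j < 9, i * i + j * j = R) : refutesTiling R = true := by
  have key : ∀ R < 72, 5 ≤ R → R ≠ 8 → (∃ i < 9, ∃ j < 9, i * i + j * j = R) →
    refutesTiling R = true := by decide +kernel
  exact key R hR h5 h8 hsq

/-! ### Lattice geometry: the bound on the radius. -/

theorem normSqPair_nonneg (v : ℤ × ℤ) : 0 ≤ normSqPair v :=
  add_nonneg (mul_self_nonneg _) (mul_self_nonneg _)

theorem normSqPair_pos {v : ℤ × ℤ} (hv : v ≠ 0) : 0 < normSqPair v := by
  refine lt_of_le_of_ne (normSqPair_nonneg v) fun h => hv ?_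
  have h1 := mul_self_nonneg v.1
  have h2 := mul_self_nonneg v.2
  simp only [normSqPair] at h
  ext
  · exact mul_self_eq_zero.1 (by omega)
  · exact mul_self_eq_zero.1 (by omega)

/-- The determinant of two vectors in `ℤ × ℤ`. -/
def detPair (v w : ℤ × ℤ) : ℤ := v.1 * w.2 - v.2 * w.1

/-- The inner product of two vectors in `ℤ × ℤ`. -/
def dotPair (v w : ℤ × ℤ) : ℤ := v.1 * w.1 + v.2 * w.2

theorem normSqPair_mul_normSqPair (v w : ℤ × ℤ) :
    normSqPair v * normSqPair w = dotPair v w ^ 2 + detPair v w ^ 2 := by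
  simp only [normSqPair, dotPair, detPair]; ring

theorem exists_normSqPair_le {S : Set (ℤ × ℤ)} (hS : S.Nonempty) :
    ∃ v ∈ S, ∀ w ∈ S, normSqPair v ≤ normSqPair w := by
  obtain ⟨v, hv, hmin⟩ :=
    WellFounded.has_min (measure fun v : ℤ × ℤ => (normSqPair v).toNat).wf S hS
  refine ⟨v, hv, fun w hw => ?_⟩
  have := hmin w hw
  have := normSqPair_nonneg w
  simp only [WellFoundedRelation.rel, InvImage] at *
  omega

/-- Rounding a quotient of integers to the nearest integer. -/
theorem exists_two_mul_abs_sub_mul_le (a : ℤ) {b : ℤ} (hb : b ≠ 0) :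
    ∃ k : ℤ, 2 * |a - k * b| ≤ |b| := by
  have key : ∀ b : ℤ, 0 < b → ∃ k : ℤ, 2 * |a - k * b| ≤ |b| := by
    intro b hb
    refine ⟨(2 * a + b) / (2 * b), ?_⟩
    have h1 := Int.emod_add_mul_ediv (2 * a + b) (2 * b)
    have h2 := Int.emod_nonneg (2 * a + b) (by omega : 2 * b ≠ 0)
    have h3 := Int.emod_lt_of_pos (2 * a + b) (by omega : 0 < 2 * b)
    generalize (2 * a + b) / (2 * b) = k at *
    have h4 : |a - k * b| * 2 ≤ b := by
      rcases abs_cases (a - k * b) with h | h <;> rw [h.1] <;> linarith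
    rw [abs_of_pos hb]
    linarith
  rcases lt_or_gt_of_ne hb with h | h
  · obtain ⟨k, hk⟩ := key (-b) (by omega)
    exact ⟨-k, by simpa using hk⟩
  · exact key b h

/-- A Gauss-reduced basis of a plane lattice. -/
theorem exists_reduced_basis {G : AddSubgroup (ℤ × ℤ)} (h1 : ∃ v ∈ G, v ≠ 0)
    (h2 : ∀ v ∈ G, v ≠ 0 → ∃ w ∈ G, detPair v w ≠ 0) :
    ∃ v ∈ G, ∃ w ∈ G, v ≠ 0 ∧ detPair v w ≠ 0 ∧ normSqPair v ≤ normSqPair w ∧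
      0 ≤ dotPair v w ∧ 2 * dotPair v w ≤ normSqPair v ∧
      ∀ l ∈ G, ∃ i j : ℤ, l = i • v + j • w := by
  -- `v` is a shortest nonzero vector and `w` a shortest one independent of it, with its sign chosen
  -- to make the inner product nonnegative.
  obtain ⟨v, ⟨hv, hv0⟩, hvmin⟩ := exists_normSqPair_le (S := {v | v ∈ G ∧ v ≠ 0}) h1
  obtain ⟨w', ⟨hw', hd'⟩, hwmin'⟩ :=
    exists_normSqPair_le (S := {w | w ∈ G ∧ detPair v w ≠ 0}) (h2 v hv hv0)
  obtain ⟨w, hw, hd, hwmin, hc⟩ : ∃ w ∈ G, detPair v w ≠ 0 ∧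
      (∀ u ∈ G, detPair v u ≠ 0 → normSqPair w ≤ normSqPair u) ∧ 0 ≤ dotPair v w := by
    rcases le_total 0 (dotPair v w') with h | h
    · exact ⟨w', hw', hd', fun u hu hdu => hwmin' u ⟨hu, hdu⟩, h⟩
    · refine ⟨-w', G.neg_mem hw', ?_, fun u hu hdu => ?_, ?_⟩
      · simp only [detPair, Prod.fst_neg, Prod.snd_neg] at hd' ⊢
        intro h; apply hd'; linarith
      · simpa [normSqPair] using hwmin' u ⟨hu, hdu⟩
      · simp only [dotPair, Prod.fst_neg, Prod.snd_neg] at h ⊢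
        linarith
  have hw0 : w ≠ 0 := by
    rintro rfl
    simp [detPair] at hd
  have hvw : normSqPair v ≤ normSqPair w := hvmin w ⟨hw, hw0⟩
  have hapos := normSqPair_pos hv0
  have hred : 2 * dotPair v w ≤ normSqPair v := by
    have h := hwmin (w - v) (G.sub_mem hw hv) (by
      intro h; apply hd; rw [← h]
      simp only [detPair, Prod.fst_sub, Prod.snd_sub]; ring)
    simp only [normSqPair, dotPair, Prod.fst_sub, Prod.snd_sub] at h ⊢
    linarith
  refine ⟨v, hv, w, hw, hv0, hd, hvw, hc, hred, fun l hl => ?_⟩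
  obtain ⟨j, hj⟩ := exists_two_mul_abs_sub_mul_le (detPair v l) hd
  obtain ⟨i, hi⟩ := exists_two_mul_abs_sub_mul_le (dotPair v (l - j • w)) hapos.ne'
  refine ⟨i, j, ?_⟩
  -- Rounding at most halves determinant and inner product, so by Lagrange's identity the remainder
  -- `u` is too short to be nonzero.
  set u := l - j • w - i • v with hu
  have huG : u ∈ G := G.sub_mem (G.sub_mem hl (G.zsmul_mem hw j)) (G.zsmul_mem hv i)
  have hdet : detPair v u = detPair v l - j * detPair v w := by
    simp only [hu, detPair, Prod.fst_sub, Prod.snd_sub, Prod.smul_fst, Prod.smul_snd, smul_eq_mul]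
    ring
  have hdot : dotPair v u = dotPair v (l - j • w) - i * normSqPair v := by
    simp only [hu, dotPair, normSqPair, Prod.fst_sub, Prod.snd_sub, Prod.smul_fst, Prod.smul_snd,
      smul_eq_mul]
    ring
  rw [← hdet] at hj
  rw [← hdot] at hi
  have hj2 : 4 * detPair v u ^ 2 ≤ detPair v w ^ 2 := by
    have := pow_le_pow_left₀ (by positivity) hj 2
    rw [mul_pow, sq_abs, sq_abs] at this
    linarith
  have hi2 : 4 * dotPair v u ^ 2 ≤ normSqPair v ^ 2 := by
    have := pow_le_pow_left₀ (by positivity) hi 2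
    rw [mul_pow, sq_abs, sq_abs] at this
    linarith
  have e1 := normSqPair_mul_normSqPair v u
  have e2 := normSqPair_mul_normSqPair v w
  have hdu : detPair v u = 0 := by
    by_contra hdu
    have := hwmin u huG hdu
    nlinarith [sq_nonneg (dotPair v w)]
  have hu0 : u = 0 := by
    by_contra hu0
    have := hvmin u ⟨huG, hu0⟩
    rw [hdu] at e1
    nlinarith
  rw [hu, sub_sub, sub_eq_zero] at hu0
  rw [hu0, add_comm]

theorem IsBallTiling.exists_ne_zero {G : AddSubgroup (ℤ × ℤ)} {R : ℕ} (h : IsBallTiling G R) :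
    ∃ v ∈ G, v ≠ 0 := by
  obtain ⟨v, hv, hp⟩ := h.covers ((R : ℤ) + 1, 0)
  refine ⟨v, hv, ?_⟩
  rintro rfl
  simp only [normSqPair, sub_zero, mul_zero, add_zero] at hp
  nlinarith

/-- A far point perpendicular to `v` cannot be covered from the line through `v`. -/
theorem IsBallTiling.exists_detPair_ne_zero {G : AddSubgroup (ℤ × ℤ)} {R : ℕ}
    (h : IsBallTiling G R) (v : ℤ × ℤ) (hv : v ≠ 0) : ∃ w ∈ G, detPair v w ≠ 0 := by
  obtain ⟨w, hw, hp⟩ := h.covers (-(((R : ℤ) + 1) * v.2), ((R : ℤ) + 1) * v.1)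
  refine ⟨w, hw, fun hd => ?_⟩
  have hvpos := normSqPair_pos hv
  have hw0 := normSqPair_nonneg w
  have e : normSqPair ((-(((R : ℤ) + 1) * v.2), ((R : ℤ) + 1) * v.1) - w) =
      ((R : ℤ) + 1) ^ 2 * normSqPair v + normSqPair w - 2 * ((R : ℤ) + 1) * detPair v w := by
    simp only [normSqPair, detPair, Prod.fst_sub, Prod.snd_sub]; ring
  rw [e, hd] at hp
  nlinarith [mul_le_mul_of_nonneg_left (show (1 : ℤ) ≤ normSqPair v by omega)
    (sq_nonneg ((R : ℤ) + 1))]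

/-- Nonzero vectors of a tiling subgroup are almost twice as long as the radius. -/
theorem IsBallTiling.four_mul_lt {G : AddSubgroup (ℤ × ℤ)} {R : ℤ} (h : IsBallTiling G R)
    {v : ℤ × ℤ} (hv : v ∈ G) (hv0 : v ≠ 0) :
    4 * R < normSqPair v + 2 * max |v.1| |v.2| + 2 := by
  have key : ∀ b1 b2 T : ℤ, 4 * (b1 * b1 + b2 * b2) ≤ T →
      4 * ((v.1 - b1) * (v.1 - b1) + (v.2 - b2) * (v.2 - b2)) ≤ T → 4 * R < T := by
    intro b1 b2 T h1 h2
    by_contra! hT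
    have : R < (v.1 - b1) * (v.1 - b1) + (v.2 - b2) * (v.2 - b2) :=
      h.disjoint v hv hv0 (b1, b2) (by simp only [normSqPair]; linarith)
    linarith
  obtain ⟨x, y⟩ := v
  simp only [normSqPair] at *
  have hx := le_max_left |x| |y|
  have hy := le_max_right |x| |y|
  generalize max |x| |y| = M at *
  obtain ⟨hx1, hx2⟩ := abs_le.1 hx
  obtain ⟨hy1, hy2⟩ := abs_le.1 hy
  obtain ⟨s, rfl | rfl⟩ := Int.even_or_odd' x <;> obtain ⟨t, rfl | rfl⟩ := Int.even_or_odd' y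
  · exact key s t _ (by linarith) (by linarith)
  · exact key s t _ (by linarith) (by linarith)
  · exact key s t _ (by linarith) (by linarith)
  -- With both coordinates odd, `v / 2` is rounded away from zero in one coordinate and towards zero
  -- in the other, so the two errors partly cancel.
  · rcases lt_or_ge s 0 with hs | hs <;> rcases lt_or_ge t 0 with ht | ht
    · exact key s (t + 1) _ (by linarith) (by linarith)
    · exact key s t _ (by linarith) (by linarith)
    · exact key s t _ (by linarith) (by linarith)
    · exact key s (t + 1) _ (by linarith) (by linarith)

/-- The vertices of an acute reduced triangle are the lattice points nearest to its circumcentre. -/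
theorem reduced_form_nonneg {a b c : ℝ} (hc : 0 ≤ c) (hca : 2 * c ≤ a) (hab : a ≤ b) (i j : ℤ) :
    0 ≤ (i : ℝ) * (i - 1) * a + j * (j - 1) * b + 2 * i * j * c := by
  have hi : (0 : ℝ) ≤ (i : ℝ) * (i - 1) := by
    rcases le_or_gt i 0 with h | h
    · have : (i : ℝ) ≤ 0 := by exact_mod_cast h
      nlinarith
    · have : (1 : ℝ) ≤ i := by exact_mod_cast h
      nlinarith
  have hj : (0 : ℝ) ≤ (j : ℝ) * (j - 1) := by
    rcases le_or_gt j 0 with h | h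
    · have : (j : ℝ) ≤ 0 := by exact_mod_cast h
      nlinarith
    · have : (1 : ℝ) ≤ j := by exact_mod_cast h
      nlinarith
  have ha : 0 ≤ a := by linarith
  rcases le_or_gt 0 (i * j) with h | h
  · have : (0 : ℝ) ≤ (i : ℝ) * j := by exact_mod_cast h
    nlinarith [mul_nonneg hi ha, mul_nonneg hj (ha.trans hab), mul_nonneg this hc]
  -- Here `2ijc ≥ ija` and `b ≥ a`, which reduces the claim to the integer inequality `key`.
  · have h' : (i : ℝ) * j ≤ 0 := by exact_mod_cast h.le
    have key : (0 : ℝ) ≤ (i : ℝ) * (i - 1) + j * (j - 1) + i * j := by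
      have : 0 ≤ i * (i - 1) + j * (j - 1) + i * j := by
        rcases mul_neg_iff.1 h with ⟨h1, h2⟩ | ⟨h1, h2⟩
        · nlinarith [sq_nonneg (i + j)]
        · nlinarith [sq_nonneg (i + j)]
      exact_mod_cast this
    nlinarith [mul_nonneg key ha, mul_nonneg hj (sub_nonneg.2 hab),
      mul_nonneg (neg_nonneg.2 h') (sub_nonneg.2 hca)]

/-- The circumcentre of a reduced triangle `0, v, w` is far from all points of the lattice spanned
by `v` and `w`. -/
theorem exists_far_point {x y x' y' : ℝ} (hab : x * x + y * y ≤ x' * x' + y' * y')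
    (hc' : 0 ≤ x * x' + y * y') (hca' : 2 * (x * x' + y * y') ≤ x * x + y * y)
    (hd' : x * y' - y * x' ≠ 0) :
    ∃ z1 z2 : ℝ, x * x + y * y ≤ 3 * (z1 ^ 2 + z2 ^ 2) ∧ ∀ i j : ℤ,
      z1 ^ 2 + z2 ^ 2 ≤ (z1 - (i * x + j * x')) ^ 2 + (z2 - (i * y + j * y')) ^ 2 := by
  set a : ℝ := x * x + y * y with ha
  set b : ℝ := x' * x' + y' * y' with hb
  set c : ℝ := x * x' + y * y' with hcdef
  set D : ℝ := x * y' - y * x' with hD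
  -- Cramer's rule for the circumcentre equations `z · v = a / 2` and `z · w = b / 2`.
  obtain ⟨z1, z2, hz1, hz2⟩ : ∃ z1 z2 : ℝ, 2 * D * z1 = a * y' - b * y ∧
      2 * D * z2 = b * x - a * x' := by
    refine ⟨(a * y' - b * y) / (2 * D), (b * x - a * x') / (2 * D), ?_, ?_⟩ <;> field_simp
  have hzv : 2 * (z1 * x + z2 * y) = a := by
    apply mul_left_cancel₀ hd'
    linear_combination x * hz1 + y * hz2 + a * hD
  have hzw : 2 * (z1 * x' + z2 * y') = b := by
    apply mul_left_cancel₀ hd'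
    linear_combination x' * hz1 + y' * hz2 + b * hD
  have hDpos : 0 < D ^ 2 := by positivity
  have e2 : D ^ 2 = a * b - c ^ 2 := by rw [ha, hb, hcdef, hD]; ring
  have ha0 : 0 ≤ a := by linarith
  have hrad : a ≤ 3 * (z1 ^ 2 + z2 ^ 2) := by
    have e1 : 4 * D ^ 2 * (z1 ^ 2 + z2 ^ 2) = a * b * (a + b - 2 * c) := by
      calc 4 * D ^ 2 * (z1 ^ 2 + z2 ^ 2) = (2 * D * z1) ^ 2 + (2 * D * z2) ^ 2 := by ring
        _ = (a * y' - b * y) ^ 2 + (b * x - a * x') ^ 2 := by rw [hz1, hz2]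
        _ = a ^ 2 * (x' * x' + y' * y') + b ^ 2 * (x * x + y * y)
            - 2 * a * b * (x * x' + y * y') := by ring
        _ = a * b * (a + b - 2 * c) := by rw [← ha, ← hb, ← hcdef]; ring
    -- The squared circumradius `ab(a + b - 2c) / (4D²)` is at least `a / 3`, with equality for
    -- equilateral triangles.
    have g : 0 ≤ 3 * b * (a + b - 2 * c) - 4 * (a * b - c ^ 2) := by
      have : 3 * b * (a + b - 2 * c) - 4 * (a * b - c ^ 2) =
        (3 * b - a) * (b - a) + (a / 2 - c) * (6 * b - 4 * c - 2 * a) := by ring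
      rw [this]
      exact add_nonneg (mul_nonneg (by linarith) (by linarith))
        (mul_nonneg (by linarith) (by linarith))
    refine le_of_mul_le_mul_left ?_ (by positivity : 0 < 4 * D ^ 2)
    have := mul_nonneg ha0 g
    rw [← e2] at this
    linarith
  refine ⟨z1, z2, hrad, fun i j => ?_⟩
  have := reduced_form_nonneg hc' hca' hab i j
  have e : (z1 - (i * x + j * x')) ^ 2 + (z2 - (i * y + j * y')) ^ 2 =
      z1 ^ 2 + z2 ^ 2 + ((i : ℝ) * (i - 1) * a + j * (j - 1) * b + 2 * i * j * c) := by
    linear_combination -i * hzv - j * hzw - i ^ 2 * ha - j ^ 2 * hb - 2 * i * j * hcdef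
  linarith

/-- The triangle inequality through a point within `√(1 / 2)` of `z`, in squared form. -/
theorem sq_dist_le_of_near {z1 z2 p1 p2 l1 l2 k : ℝ} (hk : 0 ≤ k) (h1 : |z1 - p1| ≤ 1 / 2)
    (h2 : |z2 - p2| ≤ 1 / 2) (hp : (p1 - l1) ^ 2 + (p2 - l2) ^ 2 ≤ 2 * k ^ 2) :
    (z1 - l1) ^ 2 + (z2 - l2) ^ 2 ≤ 2 * (k + 1 / 2) ^ 2 := by
  obtain ⟨e1, he1⟩ : ∃ e1, e1 = z1 - p1 := ⟨_, rfl⟩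
  obtain ⟨e2, he2⟩ : ∃ e2, e2 = z2 - p2 := ⟨_, rfl⟩
  obtain ⟨f1, hf1⟩ : ∃ f1, f1 = p1 - l1 := ⟨_, rfl⟩
  obtain ⟨f2, hf2⟩ : ∃ f2, f2 = p2 - l2 := ⟨_, rfl⟩
  rw [← he1] at h1
  rw [← he2] at h2
  rw [← hf1, ← hf2] at hp
  rw [show z1 - l1 = e1 + f1 by rw [he1, hf1]; ring, show z2 - l2 = e2 + f2 by rw [he2, hf2]; ring]
  have h1 : e1 ^ 2 ≤ (1 / 2) ^ 2 := by rw [← sq_abs]; gcongr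
  have h2 : e2 ^ 2 ≤ (1 / 2) ^ 2 := by rw [← sq_abs]; gcongr
  have he : e1 ^ 2 + e2 ^ 2 ≤ 1 / 2 := by linarith
  have hdot : e1 * f1 + e2 * f2 ≤ k := by
    refine le_of_sq_le_sq ?_ hk
    calc (e1 * f1 + e2 * f2) ^ 2 ≤ (e1 ^ 2 + e2 ^ 2) * (f1 ^ 2 + f2 ^ 2) := by
          linarith [sq_nonneg (e1 * f2 - e2 * f1)]
      _ ≤ 1 / 2 * (2 * k ^ 2) := by gcongr
      _ = k ^ 2 := by ring
  linarith

theorem IsBallTiling.lt {G : AddSubgroup (ℤ × ℤ)} {R : ℕ} (h : IsBallTiling G R) : R < 72 := by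
  obtain ⟨v, hv, w, -, hv0, hd, hab, hc, hca, hspan⟩ :=
    exists_reduced_basis h.exists_ne_zero fun v _ => h.exists_detPair_ne_zero v
  have hlong := h.four_mul_lt hv hv0
  obtain ⟨x, y⟩ := v
  obtain ⟨x', y'⟩ := w
  simp only [normSqPair, dotPair, detPair] at hab hc hca hd hlong
  obtain ⟨z1, z2, hrad, hfar⟩ := exists_far_point (x := x) (y := y) (x' := x') (y' := y')
    (by exact_mod_cast hab) (by exact_mod_cast hc) (by exact_mod_cast hca) (by exact_mod_cast hd)
  obtain ⟨l, hl, hnear⟩ := h.covers (round z1, round z2)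
  obtain ⟨i, j, rfl⟩ := hspan l hl
  -- In this scale `√R + √(1 / 2) = √2 (k + 1 / 2)`, and `R = 72` is `k = 6`.
  obtain ⟨k, hk0, hk⟩ : ∃ k : ℝ, 0 ≤ k ∧ (R : ℝ) = 2 * k ^ 2 :=
    ⟨√(R / 2), Real.sqrt_nonneg _, by rw [Real.sq_sqrt (by positivity)]; ring⟩
  have hnear : ((round z1 : ℝ) - (i * x + j * x')) ^ 2 +
      ((round z2 : ℝ) - (i * y + j * y')) ^ 2 ≤ 2 * k ^ 2 := by
    rw [← hk]
    simp only [normSqPair, Prod.smul_mk, Prod.mk_add_mk, Prod.mk_sub_mk, smul_eq_mul, ← sq] at hnear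
    exact_mod_cast hnear
  have hclose := (hfar i j).trans
    (sq_dist_le_of_near hk0 (abs_sub_round z1) (abs_sub_round z2) hnear)
  obtain ⟨S, hS, hlong⟩ : ∃ S : ℝ, S ^ 2 ≤ x * x + y * y ∧
      4 * (R : ℝ) < x * x + y * y + 2 * S + 2 := by
    refine ⟨max |(x : ℝ)| |(y : ℝ)|, ?_, by exact_mod_cast hlong⟩
    rcases max_choice |(x : ℝ)| |(y : ℝ)| with e | e <;> rw [e, sq_abs]
    · linarith [mul_self_nonneg (y : ℝ)]
    · linarith [mul_self_nonneg (x : ℝ)]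
  -- `2.4495` is just above `√6`, as `S² ≤ 3 · 2 (k + 1 / 2)²`.
  have hSk : S ≤ 2.4495 * (k + 1 / 2) := by
    refine le_of_sq_le_sq ?_ (by positivity)
    have : 0 ≤ (k + 1 / 2) ^ 2 := by positivity
    rw [mul_pow]
    linarith
  by_contra! hR
  have hR : (72 : ℝ) ≤ R := by exact_mod_cast hR
  have hk6 : 6 ≤ k := by
    refine le_of_sq_le_sq ?_ hk0
    linarith
  nlinarith

/-! ### Perfect codes and ball tilings. -/

theorem l2Dist_two (x y : Fin 2 → ℤ) :
    l2Dist x y = √((normSqPair (x 0 - y 0, x 1 - y 1) : ℤ) : ℝ) := by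
  simp only [l2Dist, Fin.sum_univ_two, normSqPair]
  push_cast
  congr 1
  ring

theorem l2Dist_le_sqrt_iff (x y : Fin 2 → ℤ) (R : ℕ) :
    l2Dist x y ≤ √(R : ℝ) ↔ normSqPair (x 0 - y 0, x 1 - y 1) ≤ R := by
  rw [l2Dist_two, Real.sqrt_le_sqrt_iff (by positivity)]
  exact_mod_cast Iff.rfl

theorem l2DistanceSet_two {r : ℝ} (hr : r ∈ l2DistanceSet 2) :
    ∃ (R : ℕ) (v : ℤ × ℤ), normSqPair v = R ∧ r = √(R : ℝ) := by
  obtain ⟨x, y, rfl⟩ := hr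
  refine ⟨(normSqPair (x 0 - y 0, x 1 - y 1)).toNat, (x 0 - y 0, x 1 - y 1), ?_, ?_⟩
  · rw [Int.toNat_of_nonneg (normSqPair_nonneg _)]
  · rw [l2Dist_two, ← Int.cast_natCast, Int.toNat_of_nonneg (normSqPair_nonneg _)]

/-- The identification of `ℤ × ℤ` with `Fin 2 → ℤ`. -/
def pairToFun : (ℤ × ℤ) →+ (Fin 2 → ℤ) where
  toFun v := ![v.1, v.2]
  map_zero' := by ext i; fin_cases i <;> rfl
  map_add' v w := by ext i; fin_cases i <;> rfl

theorem pairToFun_apply (v : ℤ × ℤ) : pairToFun v = ![v.1, v.2] := rfl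

theorem pairToFun_eta (x : Fin 2 → ℤ) : pairToFun (x 0, x 1) = x := by
  ext i; fin_cases i <;> rfl

theorem pairToFun_eq_zero {v : ℤ × ℤ} : pairToFun v = 0 ↔ v = 0 := by
  constructor
  · intro h
    ext
    · exact congrFun h 0
    · exact congrFun h 1
  · rintro rfl
    exact map_zero _

theorem IsRPerfectCode.isBallTiling {Λ : AddSubgroup (Fin 2 → ℤ)} {r : ℝ}
    (h : IsRPerfectCode (Λ : Set (Fin 2 → ℤ)) r) :
    ∃ (R : ℕ) (v : ℤ × ℤ), normSqPair v = R ∧ r = √(R : ℝ) ∧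
      IsBallTiling (Λ.comap pairToFun) R := by
  obtain ⟨⟨s, hs, hcov⟩, ⟨hrD, hrdisj⟩, hmax⟩ := h
  obtain ⟨R, v, hv, rfl⟩ := l2DistanceSet_two hrD
  refine ⟨R, v, hv, rfl, fun p => ?_, fun v hv hv0 b hb => ?_⟩
  · obtain ⟨x, ⟨hx, hxs⟩, -⟩ := hcov (pairToFun p)
    refine ⟨(x 0, x 1), ?_, ?_⟩
    · rw [AddSubgroup.mem_comap, pairToFun_eta]
      exact hx
    -- The covering radius `s` need not be achievable, but this distance is. It is at most `s`, so
    -- balls of this radius are disjoint and maximality of the packing radius applies.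
    · have hle : l2Dist x (pairToFun p) ≤ √(R : ℝ) := by
        refine hmax ⟨⟨x, _, rfl⟩, fun y hy y' hy' hne => ?_⟩
        rw [Function.onFun, Set.disjoint_left]
        intro z hz hz'
        exact hne ((hcov z).unique ⟨hy, le_trans hz hxs⟩ ⟨hy', le_trans hz' hxs⟩)
      rw [l2Dist_le_sqrt_iff] at hle
      refine le_trans (le_of_eq ?_) hle
      simp only [normSqPair, pairToFun_apply, Prod.fst_sub, Prod.snd_sub, Matrix.cons_val_zero,
        Matrix.cons_val_one]
      ring
  · by_contra! hlt
    have hdis := hrdisj (AddSubgroup.mem_comap.1 hv) Λ.zero_mem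
      (fun h0 => hv0 (pairToFun_eq_zero.1 h0))
    rw [Function.onFun, Set.disjoint_left] at hdis
    refine hdis (a := pairToFun b) ?_ ?_
    · exact (l2Dist_le_sqrt_iff _ _ _).2 hlt
    · refine (l2Dist_le_sqrt_iff _ _ _).2 (le_trans (le_of_eq ?_) hb)
      simp [normSqPair, pairToFun_apply]

/-- A tiling by balls of achievable radius is a perfect code of that radius. -/
theorem isRPerfectCode_of_existsUnique {Λ : AddSubgroup (Fin 2 → ℤ)} {R : ℕ} (hR : 0 < R)
    {u : ℤ × ℤ} (hu : normSqPair u = R)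
    (h : ∀ z : Fin 2 → ℤ, ∃! x, x ∈ Λ ∧ normSqPair (x 0 - z 0, x 1 - z 1) ≤ R) :
    IsRPerfectCode (Λ : Set (Fin 2 → ℤ)) √(R : ℝ) := by
  have hcov : ∀ z : Fin 2 → ℤ, ∃! x, x ∈ (Λ : Set (Fin 2 → ℤ)) ∧ l2Dist x z ≤ √(R : ℝ) := by
    simpa only [l2Dist_le_sqrt_iff, SetLike.mem_coe] using h
  refine ⟨⟨_, by positivity, hcov⟩, ⟨⟨pairToFun u, 0, ?_⟩, fun y hy y' hy' hne => ?_⟩, ?_⟩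
  · rw [l2Dist_two]
    simp [pairToFun_apply, hu]
  · rw [Function.onFun, Set.disjoint_left]
    intro z hz hz'
    exact hne ((hcov z).unique ⟨hy, hz⟩ ⟨hy', hz'⟩)
  · rintro s ⟨hsD, hdis⟩
    obtain ⟨S, v, hv, rfl⟩ := l2DistanceSet_two hsD
    by_contra! hlt
    have hRS : R < S := by
      rw [Real.sqrt_lt_sqrt_iff (by positivity)] at hlt
      exact_mod_cast hlt
    -- A point at distance `√S > √R` from `0` is covered by another codeword `x`, so the balls of
    -- radius `√S` around `0` and `x` meet there.
    obtain ⟨x, ⟨hx, hxz⟩, -⟩ := hcov (pairToFun v)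
    have h0 : l2Dist 0 (pairToFun v) = √(S : ℝ) := by
      rw [l2Dist_two, ← Int.cast_natCast, ← hv]
      simp [normSqPair, pairToFun_apply]
    have hx0 : x ≠ 0 := by
      rintro rfl
      rw [h0] at hxz
      exact absurd hlt (not_lt.2 hxz)
    have hd := hdis hx Λ.zero_mem hx0
    rw [Function.onFun, Set.disjoint_left] at hd
    exact hd (a := pairToFun v) (hxz.trans hlt.le) h0.le

/-- A subgroup cut out by one congruence modulo `N` tiles as soon as the ball is a complete system
of residues for it. -/
theorem existsUnique_of_residues {Λ : AddSubgroup (Fin 2 → ℤ)} {R : ℕ} (n : ℕ) (α β : ℤ) (N : ℕ)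
    (hN : 0 < N) (hn : (R : ℤ) < (n + 1) * (n + 1))
    (hΛ : ∀ z : Fin 2 → ℤ, z ∈ Λ ↔ (N : ℤ) ∣ α * z 0 + β * z 1)
    (hex : ∀ t < N, ∃ i ∈ symmRange n, ∃ j ∈ symmRange n,
      normSqPair (i, j) ≤ R ∧ (N : ℤ) ∣ α * i + β * j - t)
    (huniq : ∀ i ∈ symmRange n, ∀ j ∈ symmRange n, normSqPair (i, j) ≤ R →
      ∀ i' ∈ symmRange n, ∀ j' ∈ symmRange n, normSqPair (i', j') ≤ R →
      (N : ℤ) ∣ α * (i - i') + β * (j - j') → i = i' ∧ j = j')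
    (z : Fin 2 → ℤ) : ∃! x, x ∈ Λ ∧ normSqPair (x 0 - z 0, x 1 - z 1) ≤ R := by
  have hNZ : (0 : ℤ) < N := by exact_mod_cast hN
  obtain ⟨i, -, j, -, hij, hdvd⟩ := hex ((-(α * z 0 + β * z 1)) % N).toNat (by
    have := Int.emod_lt_of_pos (-(α * z 0 + β * z 1)) hNZ
    omega)
  rw [Int.toNat_of_nonneg (Int.emod_nonneg _ hNZ.ne')] at hdvd
  have hmem : ∀ i j : ℤ, normSqPair (i, j) ≤ R → i ∈ symmRange n ∧ j ∈ symmRange n := by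
    intro i j hij
    simp only [normSqPair] at hij
    exact ⟨mem_symmRange (by nlinarith [mul_self_nonneg j]),
      mem_symmRange (by nlinarith [mul_self_nonneg i])⟩
  have hy : ![z 0 + i, z 1 + j] ∈ Λ := by
    rw [hΛ]
    have h1 := Int.dvd_sub_self_of_emod_eq (Eq.refl (-(α * z 0 + β * z 1) % N))
    have h2 := dvd_add hdvd h1
    rw [sub_add_sub_cancel] at h2
    change (N : ℤ) ∣ α * (z 0 + i) + β * (z 1 + j)
    rwa [show α * (z 0 + i) + β * (z 1 + j) = α * i + β * j - -(α * z 0 + β * z 1) by ring]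
  refine ⟨![z 0 + i, z 1 + j], ⟨hy, by simpa using hij⟩, ?_⟩
  · rintro x ⟨hx, hxz⟩
    have hd := (hΛ _).1 (Λ.sub_mem hx hy)
    obtain ⟨h1, h2⟩ := hmem _ _ hxz
    obtain ⟨h3, h4⟩ := hmem _ _ hij
    obtain ⟨e1, e2⟩ := huniq _ h1 _ h2 hxz _ h3 _ h4 hij (by
      simp only [Pi.sub_apply, Matrix.cons_val_zero, Matrix.cons_val_one] at hd
      convert hd using 1
      ring)
    rw [← pairToFun_eta x, pairToFun_apply]
    congr 1
    · exact eq_add_of_sub_eq' e1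
    · rw [show x 1 = z 1 + j from eq_add_of_sub_eq' e2]

/-! ### The four codes. -/

/-- In each example the modulus, 5, 9, 13 or 25, is both the number of points in the ball and the
absolute determinant of the generators. -/
theorem isRPerfectCode_closure_one : IsRPerfectCode
    (AddSubgroup.closure ({![1, 2], ![0, 5]} : Set (Fin 2 → ℤ)) : Set (Fin 2 → ℤ)) 1 := by
  have h := isRPerfectCode_of_existsUnique (R := 1) one_pos (u := (1, 0)) rfl
    (existsUnique_of_residues (Λ := AddSubgroup.closure {![1, 2], ![0, 5]}) 1 (-2) 1 5 (by norm_num)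
      (by norm_num) (fun z => ?_) (by decide +kernel) (by decide +kernel))
  · simpa using h
  · rw [AddSubgroup.mem_closure_pair]
    constructor
    · rintro ⟨m, n, rfl⟩
      simp
      omega
    · rintro ⟨k, hk⟩
      push_cast at hk
      refine ⟨z 0, k, ?_⟩
      ext i
      fin_cases i <;> simp
      omega

theorem isRPerfectCode_closure_sqrt_two : IsRPerfectCode
    (AddSubgroup.closure ({![3, 2], ![0, 3]} : Set (Fin 2 → ℤ)) : Set (Fin 2 → ℤ)) √2 := by
  have h := isRPerfectCode_of_existsUnique (R := 2) two_pos (u := (1, 1)) rfl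
    (existsUnique_of_residues (Λ := AddSubgroup.closure {![3, 2], ![0, 3]}) 1 1 3 9 (by norm_num)
      (by norm_num) (fun z => ?_) (by decide +kernel) (by decide +kernel))
  · simpa using h
  · rw [AddSubgroup.mem_closure_pair]
    constructor
    · rintro ⟨m, n, rfl⟩
      simp
      omega
    · rintro ⟨k, hk⟩
      push_cast at hk
      refine ⟨3 * k - z 1, z 1 - 2 * k, ?_⟩
      ext i
      fin_cases i <;> simp <;> omega

theorem isRPerfectCode_closure_two : IsRPerfectCode
    (AddSubgroup.closure ({![1, 5], ![3, 2]} : Set (Fin 2 → ℤ)) : Set (Fin 2 → ℤ)) 2 := by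
  have h := isRPerfectCode_of_existsUnique (R := 4) four_pos (u := (2, 0)) rfl
    (existsUnique_of_residues (Λ := AddSubgroup.closure {![1, 5], ![3, 2]}) 2 (-5) 1 13
      (by norm_num) (by norm_num) (fun z => ?_) (by decide +kernel) (by decide +kernel))
  · rwa [show ((4 : ℕ) : ℝ) = 2 ^ 2 by norm_num, Real.sqrt_sq two_pos.le] at h
  · rw [AddSubgroup.mem_closure_pair]
    constructor
    · rintro ⟨m, n, rfl⟩
      simp
      omega
    · rintro ⟨k, hk⟩
      push_cast at hk
      refine ⟨z 0 + 3 * k, -k, ?_⟩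
      ext i
      fin_cases i <;> simp <;> omega

theorem isRPerfectCode_closure_two_mul_sqrt_two : IsRPerfectCode
    (AddSubgroup.closure ({![5, 4], ![0, 5]} : Set (Fin 2 → ℤ)) : Set (Fin 2 → ℤ)) (2 * √2) := by
  have h := isRPerfectCode_of_existsUnique (R := 8) (by norm_num) (u := (2, 2)) rfl
    (existsUnique_of_residues (Λ := AddSubgroup.closure {![5, 4], ![0, 5]}) 2 1 5 25
      (by norm_num) (by norm_num) (fun z => ?_) (by decide +kernel) (by decide +kernel))
  · rwa [show ((8 : ℕ) : ℝ) = 2 ^ 2 * 2 by norm_num, Real.sqrt_mul (by positivity),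
      Real.sqrt_sq two_pos.le] at h
  · rw [AddSubgroup.mem_closure_pair]
    constructor
    · rintro ⟨m, n, rfl⟩
      simp
      omega
    · rintro ⟨k, hk⟩
      push_cast at hk
      refine ⟨5 * k - z 1, z 1 - 4 * k, ?_⟩
      ext i
      fin_cases i <;> simp <;> omega

/-! ### The classification. -/

theorem exists_nat_sq_add_sq {v : ℤ × ℤ} {R n : ℕ} (hv : normSqPair v = R) (hR : R < n * n) :
    ∃ i < n, ∃ j < n, i * i + j * j = R := by
  have h : v.1.natAbs * v.1.natAbs + v.2.natAbs * v.2.natAbs = R := by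
    zify
    simpa [normSqPair] using hv
  exact ⟨v.1.natAbs, by nlinarith, v.2.natAbs, by nlinarith, h⟩

theorem IsRPerfectCode.radius_eq {r : ℝ} (hr : 0 < r) {Λ : AddSubgroup (Fin 2 → ℤ)}
    (h : IsRPerfectCode (Λ : Set (Fin 2 → ℤ)) r) : r = 1 ∨ r = √2 ∨ r = 2 ∨ r = 2 * √2 := by
  obtain ⟨R, v, hv, rfl, ht⟩ := h.isBallTiling
  have hR0 : R ≠ 0 := by
    rintro rfl
    simp at hr
  have hR3 : R ≠ 3 := by
    rintro rfl
    have := exists_nat_sq_add_sq (n := 2) hv (by norm_num)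
    revert this
    decide
  have hR : R < 5 ∨ R = 8 := by
    by_contra! hR
    exact not_isBallTiling_of_refutesTiling (refutesTiling_of_lt R hR.1 hR.2 ht.lt
      (exists_nat_sq_add_sq (n := 9) hv (ht.lt.trans (by norm_num)))) ht
  have hcases : R = 1 ∨ R = 2 ∨ R = 4 ∨ R = 8 := by omega
  rcases hcases with rfl | rfl | rfl | rfl
  · left; simp
  · right; left; simp
  · right; right; left
    rw [show ((4 : ℕ) : ℝ) = 2 ^ 2 by norm_num, Real.sqrt_sq two_pos.le]
  · right; right; right
    rw [show ((8 : ℕ) : ℝ) = 2 ^ 2 * 2 by norm_num, Real.sqrt_mul (by positivity),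
      Real.sqrt_sq two_pos.le]

theorem theorem2 :
    (∀ r : ℝ, 0 < r → ∀ Λ : AddSubgroup (Fin 2 → ℤ),
      IsRPerfectCode (Λ : Set (Fin 2 → ℤ)) r →
        r = 1 ∨ r = Real.sqrt 2 ∨ r = 2 ∨ r = 2 * Real.sqrt 2) ∧
    IsRPerfectCode
      (AddSubgroup.closure ({![1, 2], ![0, 5]} : Set (Fin 2 → ℤ)) : Set (Fin 2 → ℤ)) 1 ∧
    IsRPerfectCode
      (AddSubgroup.closure ({![3, 2], ![0, 3]} : Set (Fin 2 → ℤ)) : Set (Fin 2 → ℤ)) (Real.sqrt 2) ∧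
    IsRPerfectCode
      (AddSubgroup.closure ({![1, 5], ![3, 2]} : Set (Fin 2 → ℤ)) : Set (Fin 2 → ℤ)) 2 ∧
    IsRPerfectCode
      (AddSubgroup.closure ({![5, 4], ![0, 5]} : Set (Fin 2 → ℤ)) : Set (Fin 2 → ℤ)) (2 * Real.sqrt 2) := by
  exact ⟨fun r hr Λ h => h.radius_eq hr, isRPerfectCode_closure_one,
    isRPerfectCode_closure_sqrt_two, isRPerfectCode_closure_two,
    isRPerfectCode_closure_two_mul_sqrt_two⟩
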